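/- Let $G=(V,E)$ be a finite simple graph with at least one edge. For $v\in V$ let $\partial(v)$ be the set of edges of $G$ incident to $v$. A transition system $T$ on $G$ assigns to every vertex $v$ a (simple) graph $T(v)$ whose vertex set is $\partial(v)$. A compatible closed trail is a closed walk $v_1,e_1,v_2,e_2,\dots,e_k,v_{k+1}=v_1$ of $G$ with $k\ge 1$ and pairwise distinct edges $e_1,\dots,e_k$, such that $e_i$ and $e_{i+1}$ are adjacent in $T(v_{i+1})$ for all $1\le i<k$, and $e_k$ and $e_1$ are adjacent in $T(v_1)$. Theorem. Suppose that for every vertex $v$ the graph $T(v)$ is connected (for an isolated vertex $v$, the graph $T(v)$ has no vertices and counts as connected). If $G$ has no compatible closed trail, then $G$ has a bridge, that is, an edge whose two endpoints lie in different connected components of the graph obtained from $G$ by deleting that edge. -/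

import Mathlib

namespace SimpleGraph

universe u

/-- A transition system on `G`: for every vertex `v`, a transition graph `T(v)`, that is, a graph
whose vertices are the edges of `G` incident to `v`. Adjacency in `T(v)` means that the transition
is allowed. -/
structure TransitionSystem {V : Type u} (G : SimpleGraph V) where
  /-- The transition graph at `v`. -/
  transitionGraph : (v : V) → SimpleGraph (G.incidenceSet v)

namespace TransitionSystem

variable {V : Type u} {G : SimpleGraph V}

/-- `e` and `f` are both incident to `v` and are adjacent in the transition graph `T(v)`. -/
def Allowed (T : G.TransitionSystem) (v : V) (e f : Sym2 V) : Prop :=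
  ∃ (he : e ∈ G.incidenceSet v) (hf : f ∈ G.incidenceSet v),
    (T.transitionGraph v).Adj ⟨e, he⟩ ⟨f, hf⟩

/-- A walk is compatible if any two consecutive edges of it are adjacent in the transition graph of
the vertex at which the walk passes from the first to the second. -/
def IsCompatible (T : G.TransitionSystem) {u v : V} (p : G.Walk u v) : Prop :=
  p.darts.IsChain fun d d' => T.Allowed d.snd d.edge d'.edge

/-- A compatible closed trail: a closed walk with at least one edge and no repeated edge, which is
compatible, the transition from its last edge to its first edge included. -/
def IsCompatibleClosedTrail (T : G.TransitionSystem) {v : V} (p : G.Walk v v) : Prop :=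
  p.IsTrail ∧ T.IsCompatible p ∧
    ∃ hp : ¬ p.Nil, T.Allowed v (p.lastDart hp).edge (p.firstDart hp).edge

end TransitionSystem

end SimpleGraph

namespace SimpleGraph

namespace TransitionSystem

variable {V : Type*} {G : SimpleGraph V} {T : G.TransitionSystem}

/-! Choose a dart `d` from which compatible trails reach as few darts as possible. By
`Reaches.symm_or_of_follows`, minimality lets every allowed transition out of a reached dart be
reversed, so connectedness of `T(v)` spreads reachability to all darts into `v` once one is reached
(`reaches_of_snd_eq`). The tail of `d` is not the head of a reached dart, since otherwise `d.symm`
would be reached, using one edge twice. Yet the set of heads of reached darts is closed under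
walking in `G` minus the edge of `d`, so that edge is a bridge. -/

lemma Allowed.symm {v : V} {e f : Sym2 V} (h : T.Allowed v e f) : T.Allowed v f e := by
  obtain ⟨he, hf, h⟩ := h
  exact ⟨hf, he, h.symm⟩

/-- The dart `e` starts where `d` ends, and the transition from `d` to `e` is allowed. -/
def Follows (T : G.TransitionSystem) (d e : G.Dart) : Prop :=
  d.snd = e.fst ∧ T.Allowed d.snd d.edge e.edge

lemma Follows.symm {d e : G.Dart} (h : T.Follows d e) : T.Follows e.symm d.symm := by
  obtain ⟨h₁, h₂⟩ := h
  refine ⟨h₁.symm, ?_⟩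
  rw [Dart.edge_symm, Dart.edge_symm]
  change T.Allowed e.fst _ _
  exact h₁ ▸ h₂.symm

/-- The list of darts of a compatible trail. -/
structure IsDartTrail (T : G.TransitionSystem) (l : List G.Dart) : Prop where
  isChain : l.IsChain T.Follows
  nodup : (l.map Dart.edge).Nodup

/-- Some compatible trail starts with the dart `d` and ends with the dart `f`. -/
def Reaches (T : G.TransitionSystem) (d f : G.Dart) : Prop :=
  ∃ l, T.IsDartTrail l ∧ l.head? = some d ∧ l.getLast? = some f

lemma Reaches.refl (d : G.Dart) : T.Reaches d d :=
  ⟨[d], ⟨by simp, by simp⟩, rfl, rfl⟩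

lemma isDartTrail_append {l₁ l₂ : List G.Dart} :
    T.IsDartTrail (l₁ ++ l₂) ↔ T.IsDartTrail l₁ ∧ T.IsDartTrail l₂ ∧
      (∀ x ∈ l₁.getLast?, ∀ y ∈ l₂.head?, T.Follows x y) ∧
      ∀ x ∈ l₁, ∀ y ∈ l₂, x.edge ≠ y.edge := by
  constructor
  · rintro ⟨h₁, h₂⟩
    rw [List.isChain_append] at h₁
    rw [List.map_append, List.nodup_append] at h₂
    exact ⟨⟨h₁.1, h₂.1⟩, ⟨h₁.2.1, h₂.2.1⟩, h₁.2.2, fun x hx y hy =>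
      h₂.2.2 _ (List.mem_map_of_mem hx) _ (List.mem_map_of_mem hy)⟩
  · rintro ⟨h₁, h₂, h₃, h₄⟩
    refine ⟨List.isChain_append.2 ⟨h₁.1, h₂.1, h₃⟩, ?_⟩
    rw [List.map_append, List.nodup_append]
    refine ⟨h₁.2, h₂.2, ?_⟩
    simpa using h₄

lemma IsDartTrail.reverse {l : List G.Dart} (h : T.IsDartTrail l) :
    T.IsDartTrail (l.map Dart.symm).reverse := by
  refine ⟨?_, ?_⟩
  · rw [List.isChain_reverse, List.isChain_map]
    exact h.isChain.imp fun _ _ => Follows.symm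
  · rw [List.map_reverse, List.nodup_reverse, List.map_map]
    simpa [Function.comp_def] using h.nodup

/-- A compatible trail of darts whose last dart is followed by its first one closes up. -/
lemma exists_isCompatibleClosedTrail {l : List G.Dart} (hl : T.IsDartTrail l) (hne : l ≠ [])
    (h : T.Follows (l.getLast hne) (l.head hne)) :
    ∃ (v : V) (p : G.Walk v v), T.IsCompatibleClosedTrail p := by
  have hc : l.IsChain G.DartAdj := hl.isChain.imp fun _ _ h => h.1
  obtain ⟨u, v, p, hp, hu, hv⟩ : ∃ (u v : V) (p : G.Walk u v), p.darts = l ∧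
      u = (l.head hne).fst ∧ v = (l.getLast hne).snd :=
    ⟨_, _, Walk.ofDarts l hne hc, Walk.darts_ofDarts hne hc, rfl, rfl⟩
  obtain rfl : u = v := by rw [hu, hv, h.1]
  subst hp
  have hn : ¬ p.Nil := fun hn => hne (Walk.darts_eq_nil.2 hn)
  refine ⟨_, p, ⟨hl.nodup⟩, hl.isChain.imp fun _ _ h => h.2, hn, ?_⟩
  have := h.2
  rw [← hv] at this
  rwa [p.lastDart_eq_getLast_darts hn, p.firstDart_eq_head_darts hn]

lemma _root_.List.exists_first_mem {α : Type*} (p : α → Prop) {l : List α} (h : ∃ x ∈ l, p x) :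
    ∃ l₁ x l₂, l = l₁ ++ x :: l₂ ∧ p x ∧ ∀ y ∈ l₁, ¬ p y := by
  induction l with
  | nil => simp at h
  | cons a l ih =>
    by_cases ha : p a
    · exact ⟨[], a, l, rfl, ha, by simp⟩
    · obtain ⟨l₁, x, l₂, rfl, hx, hl⟩ := ih (by simpa [ha] using h)
      exact ⟨a :: l₁, x, l₂, rfl, hx, by simpa [ha] using hl⟩

/-- If `f` is reachable from `d` and `g` follows `f`, then either the reversal of `g` is reachable
from `d`, or everything reachable from `g` is reachable from `d` but `d` is not reachable from
`g`. -/
lemma Reaches.symm_or_of_follows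
    (hC : ¬ ∃ (v : V) (p : G.Walk v v), T.IsCompatibleClosedTrail p) {d f g : G.Dart}
    (hf : T.Reaches d f) (hfg : T.Follows f g) :
    T.Reaches d g.symm ∨ (∀ w, T.Reaches g w → T.Reaches d w) ∧ ¬ T.Reaches g d := by
  obtain ⟨P, hP, hPd, hPf⟩ := hf
  refine or_iff_not_imp_left.2 fun hg => ?_
  have hdP : d ∈ P := List.mem_of_mem_head? hPd
  have hclosed : ∀ l : List G.Dart, T.IsDartTrail l → ∀ x ∈ l.head?, ∀ y ∈ l.getLast?,
      ¬ T.Follows y x := by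
    intro l hl x hx y hy h
    have hne : l ≠ [] := by rintro rfl; simp at hx
    refine hC (exists_isCompatibleClosedTrail hl hne ?_)
    rw [List.head?_eq_some_head hne] at hx
    rw [List.getLast?_eq_some_getLast hne] at hy
    simp only [Option.mem_def, Option.some.injEq] at hx hy
    rwa [hx, hy]
  have hprefix : ∀ x ∈ P, ∃ P₁ P₂, P = (P₁ ++ [x]) ++ P₂ ∧ T.IsDartTrail (P₁ ++ [x]) ∧
      (P₁ ++ [x]).head? = some d := by
    intro x hx
    obtain ⟨P₁, P₂, rfl⟩ := List.append_of_mem hx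
    rw [List.append_cons] at hP
    refine ⟨P₁, P₂, by simp, (isDartTrail_append.1 hP).1, ?_⟩
    rw [← hPd]
    cases P₁ <;> simp
  have hgP : ∀ x ∈ P, g.edge ≠ x.edge := by
    intro x hx hgx
    rcases (dart_edge_eq_iff g x).1 hgx with rfl | rfl
    -- Same direction: the part of `P` from `g` to `f` closes up.
    · obtain ⟨P₁, P₂, rfl⟩ := List.append_of_mem hx
      exact hclosed (g :: P₂) (isDartTrail_append.1 hP).2.1 g rfl f (by simpa using hPf) hfg
    · obtain ⟨P₁, P₂, -, h, h'⟩ := hprefix x hx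
      exact hg ⟨_, h, h', by simp⟩
  have hdisj : ∀ Q, T.IsDartTrail Q → Q.head? = some g → ∀ x ∈ P, ∀ y ∈ Q, x.edge ≠ y.edge := by
    intro Q hQ hQg x hx y hy hxy
    -- Cut `Q` at its first dart `q` whose edge lies on `P`.
    obtain ⟨Q₁, q, Q₂, rfl, ⟨z, hz, hqz⟩, hQ₁⟩ :=
      List.exists_first_mem (fun y : G.Dart => ∃ x ∈ P, y.edge = x.edge) ⟨y, hy, x, hx, hxy.symm⟩
    obtain ⟨Q₁, rfl⟩ : ∃ Q₁', Q₁ = g :: Q₁' := by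
      cases Q₁ with
      | nil =>
        obtain rfl : q = g := by simpa using hQg
        exact absurd hqz (hgP z hz)
      | cons a Q₁ =>
        obtain rfl : a = g := by simpa using hQg
        exact ⟨_, rfl⟩
    obtain ⟨hQ₁t, -, hQq, -⟩ := isDartTrail_append.1 hQ
    rcases (dart_edge_eq_iff q z).1 hqz with rfl | rfl
    -- Same direction: `P` from `q` to `f`, then `Q` from `g` until just before `q`, closes up.
    · obtain ⟨P₁, P₂, rfl⟩ := List.append_of_mem hz
      have hP₂ : (q :: P₂).getLast? = some f := by simpa using hPf
      have ht : T.IsDartTrail ((q :: P₂) ++ (g :: Q₁)) := by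
        refine isDartTrail_append.2 ⟨(isDartTrail_append.1 hP).2.1, hQ₁t, ?_, ?_⟩
        · rw [hP₂]
          rintro x ⟨⟩ y ⟨⟩
          exact hfg
        · exact fun x hx y hy h => hQ₁ y hy ⟨x, List.mem_append_right _ hx, h.symm⟩
      obtain ⟨r, hr⟩ : ∃ r, (g :: Q₁).getLast? = some r :=
        ⟨_, List.getLast?_eq_some_getLast (List.cons_ne_nil _ _)⟩
      exact hclosed _ ht q rfl r (by rw [List.getLast?_append, hr]; rfl) (hQq r hr q rfl)
    -- Opposite directions: follow `P` up to `z`, then `Q` backwards, arriving at `g.symm`.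
    · obtain ⟨P₁, P₂, hPeq, h, h'⟩ := hprefix z hz
      refine hg ⟨(P₁ ++ [z]) ++ ((g :: Q₁).map Dart.symm).reverse,
        isDartTrail_append.2 ⟨h, hQ₁t.reverse, ?_, ?_⟩, ?_, ?_⟩
      · intro x hx y hy
        obtain rfl : z = x := by simpa using hx
        rw [List.head?_reverse, List.getLast?_map] at hy
        obtain ⟨r, hr, rfl⟩ := Option.mem_map.1 hy
        exact (hQq r hr _ rfl).symm
      · intro x hx y hy hxy
        rw [List.mem_reverse, List.mem_map] at hy
        obtain ⟨w, hw, rfl⟩ := hy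
        rw [Dart.edge_symm] at hxy
        exact hQ₁ w hw ⟨x, hPeq ▸ List.mem_append_left _ hx, hxy.symm⟩
      · rw [List.head?_append, h']; rfl
      · rw [List.getLast?_append, List.getLast?_reverse]; rfl
  refine ⟨?_, ?_⟩
  · rintro w ⟨Q, hQ, hQg, hQw⟩
    refine ⟨P ++ Q, isDartTrail_append.2 ⟨hP, hQ, ?_, hdisj Q hQ hQg⟩, ?_, ?_⟩
    · rw [hPf, hQg]
      rintro x ⟨⟩ y ⟨⟩
      exact hfg
    · rw [List.head?_append, hPd]; rfl
    · rw [List.getLast?_append, hQw]; rfl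
  · rintro ⟨Q, hQ, hQg, hQd⟩
    exact hdisj Q hQ hQg d hdP d (List.mem_of_getLast? hQd) rfl

/-- In the absence of compatible closed trails, some set of darts of the form "reachable from `d`"
is closed under allowed transitions at the heads of its darts. -/
lemma exists_dart_reaches_symm_of_follows [Finite V] (hE : G.edgeSet.Nonempty)
    (hC : ¬ ∃ (v : V) (p : G.Walk v v), T.IsCompatibleClosedTrail p) :
    ∃ d : G.Dart, ∀ f g, T.Reaches d f → T.Follows f g → T.Reaches d g.symm := by
  have : Finite G.Dart := Finite.of_injective _ Dart.toProd_injective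
  have : Nonempty G.Dart := by
    obtain ⟨⟨u, v⟩, he⟩ := hE
    exact ⟨⟨(u, v), he⟩⟩
  obtain ⟨d, hd⟩ := Finite.exists_min fun d : G.Dart => {f | T.Reaches d f}.ncard
  refine ⟨d, fun f g hf hfg => (hf.symm_or_of_follows hC hfg).resolve_right ?_⟩
  rintro ⟨h₁, h₂⟩
  refine (hd g).not_gt (Set.ncard_lt_ncard ⟨h₁, fun h => h₂ (h (Reaches.refl d))⟩ (Set.toFinite _))

/-- If all transition graphs are connected, a dart as in `exists_dart_reaches_symm_of_follows`
reaches all darts into the head of any dart that it reaches. -/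
lemma reaches_of_snd_eq (hT : ∀ v : V, (T.transitionGraph v).Preconnected) {d : G.Dart}
    (hd : ∀ f g, T.Reaches d f → T.Follows f g → T.Reaches d g.symm) {f g : G.Dart}
    (hf : T.Reaches d f) (hfg : f.snd = g.snd) : T.Reaches d g := by
  have hinc : ∀ x : G.Dart, x.edge ∈ G.incidenceSet x.snd := fun x =>
    ⟨x.edge_mem, Sym2.mem_mk_right _ _⟩
  have key : ∀ a b : G.incidenceSet g.snd, (T.transitionGraph g.snd).Walk a b →
      ∀ x : G.Dart, x.snd = g.snd → x.edge = a.1 → T.Reaches d x →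
      ∀ y : G.Dart, y.snd = g.snd → y.edge = b.1 → T.Reaches d y := by
    intro a b p
    induction p with
    | nil =>
      intro x hx hxa hxd y hy hyb
      rcases (dart_edge_eq_iff x y).1 (hxa.trans hyb.symm) with rfl | rfl
      · exact hxd
      · exact absurd (hx.trans hy.symm) y.fst_ne_snd
    | @cons a c b hac p ih =>
      intro x hx hxa hxd y hy hyb
      obtain ⟨w, hw⟩ := Sym2.mem_iff_exists.1 c.2.2
      have hadj : G.Adj g.snd w := by
        rw [← mem_edgeSet, ← hw]
        exact c.2.1
      let z : G.Dart := ⟨(g.snd, w), hadj⟩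
      have hz : z.edge = c.1 := hw.symm
      -- Leaving along `c` is an allowed transition, so by `hd` the dart entering along `c` is
      -- reached.
      refine ih z.symm rfl (by rw [Dart.edge_symm, hz]) (hd x z hxd ⟨hx, ?_⟩) y hy hyb
      rw [hx, hxa, hz]
      exact ⟨a.2, c.2, hac⟩
  obtain ⟨p⟩ := hT g.snd ⟨f.edge, hfg ▸ hinc f⟩ ⟨g.edge, hinc g⟩
  exact key _ _ p f hfg rfl hf g rfl rfl

/-- Dropping the last dart of a trail leaves a trail from `d`, unless nothing remains. -/
lemma Reaches.eq_or_exists {d f : G.Dart} (h : T.Reaches d f) :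
    f = d ∨ ∃ e, T.Reaches d e ∧ e.snd = f.fst := by
  obtain ⟨l, hl, hd, hf⟩ := h
  obtain ⟨l, rfl⟩ := List.getLast?_eq_some_iff.1 hf
  rcases l.eq_nil_or_concat with rfl | ⟨l, e, rfl⟩
  · exact Or.inl (by simpa using hd)
  · obtain ⟨h₁, -, h₂, -⟩ := isDartTrail_append.1 hl
    refine Or.inr ⟨e, ⟨_, h₁, ?_, by simp⟩, (h₂ e (by simp) f rfl).1⟩
    rw [← hd]
    cases l <;> simp

lemma not_reaches_symm (d : G.Dart) : ¬ T.Reaches d d.symm := by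
  rintro ⟨l, hl, hd, hf⟩
  obtain ⟨l, rfl⟩ := List.getLast?_eq_some_iff.1 hf
  cases l with
  | nil => exact d.symm_ne (by simpa using hd)
  | cons a l =>
    obtain rfl : a = d := by simpa using hd
    exact (isDartTrail_append.1 hl).2.2.2 a (by simp) a.symm (by simp) a.edge_symm.symm

end TransitionSystem

end SimpleGraph

theorem mainTheorem2 {V : Type*} [Finite V] (G : SimpleGraph V) (T : G.TransitionSystem)
    (hE : G.edgeSet.Nonempty)
    (hT : ∀ v : V, (T.transitionGraph v).Preconnected)
    (hC : ¬ ∃ (v : V) (p : G.Walk v v), T.IsCompatibleClosedTrail p) :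
    ∃ e ∈ G.edgeSet, G.IsBridge e := by
  obtain ⟨d, hd⟩ := SimpleGraph.TransitionSystem.exists_dart_reaches_symm_of_follows hE hC
  have hfst : ¬ ∃ f, T.Reaches d f ∧ f.snd = d.fst := by
    rintro ⟨f, hf, hfd⟩
    exact SimpleGraph.TransitionSystem.not_reaches_symm d (SimpleGraph.TransitionSystem.reaches_of_snd_eq hT hd hf hfd)
  have hstep : ∀ u v, (G.deleteEdges {d.edge}).Walk u v →
      (∃ f, T.Reaches d f ∧ f.snd = u) → ∃ f, T.Reaches d f ∧ f.snd = v := by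
    intro u v p
    induction p with
    | nil => exact id
    | @cons u w v huw p ih =>
      rintro ⟨f, hf, hfu⟩
      rw [SimpleGraph.deleteEdges_adj] at huw
      let g : G.Dart := ⟨(w, u), huw.1.symm⟩
      rcases (SimpleGraph.TransitionSystem.reaches_of_snd_eq hT hd hf (g := g) hfu).eq_or_exists with h | h
      -- If the reached dart is `d` itself, the walk has used the deleted edge.
      · refine absurd ?_ huw.2
        rw [← h]
        exact Sym2.eq_swap
      · exact ih h
  refine ⟨d.edge, d.edge_mem, ?_⟩
  change ¬ (G.deleteEdges {d.edge}).Reachable d.fst d.snd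
  intro h
  obtain ⟨p⟩ := h.symm
  exact hfst (hstep _ _ p ⟨d, SimpleGraph.TransitionSystem.Reaches.refl d, rfl⟩)
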